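/- Let $F/\mathbf{F}_q$ be an algebraic function field of one variable over a finite field, let $Q, P_1,\dots,P_n$ be distinct places of degree one of $F$, and put $D=P_1+\cdots+P_n$. Let $v_Q$ be the normalized valuation at $Q$, and for a divisor $G$ put $\mathcal{L}(G+\infty Q)=\bigcup_{i}\mathcal{L}(G+iQ)$. Let $S=H(Q)$ be the Weierstrass semigroup at $Q$ (the set of nongaps), generated by positive integers $a_1,\dots,a_t$ ($t\ge 1$), and let $x_1,\dots,x_t\in F$ have pole divisors $(x_i)_\infty=a_iQ$. For $0\le i<a_1$ let $b_i=\min\{m\in S\mid m\equiv i \pmod{a_1}\}$, and let $L_i=(\ell_{i1},\dots,\ell_{it})$ be the $\prec$-least vector $(m_1,\dots,m_t)\in\mathbf{N}_0^t$ with $a_1m_1+\cdots+a_tm_t=b_i$, where $\prec$ compares vectors first by the weight $a_1m_1+\cdots+a_tm_t$ and, for equal weights, regards as smaller the vector having the larger entry at the first index where the two differ (so $\ell_{i1}=0$). Put $y_i=x_1^{\ell_{i1}}\cdots x_t^{\ell_{it}}$. For $0\le j<a_1$ let $\eta_j$ be any nonzero element of $\mathcal{L}(-D+\infty Q)$ whose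 pole order $-v_Q(\eta_j)$ is minimal among the nonzero $\eta\in\mathcal{L}(-D+\infty Q)$ with $-v_Q(\eta)\equiv j\pmod{a_1}$. For integers $u$ let $C_u=\{(f(P_1),\dots,f(P_n))\mid f\in\mathcal{L}(uQ)\}$ and let $S_{\mathrm{indep}}=\{u\mid C_u\ne C_{u-1}\}$. For $s\in S$ define $$\nu(s)=\frac1{a_1}\sum_{0\le i<a_1}\max\{-v_Q(\eta_{i'})+v_Q(y_i)-s,\,0\},\quad i'=(i+s)\bmod a_1,\qquad \lambda(s)=|\{j\in S\mid j+s\in S_{\mathrm{indep}}\}|.$$ Then for every $s\in S$ the set $\{j\in S\mid j+s\in S_{\mathrm{indep}}\}$ is finite and $\nu(s)=\lambda(s)$. Consequently, for every finite nonempty $\Gamma\subset S$, $$\tfrac12\min_{s\in\Gamma}\nu(s)=\tfrac12\,d_{\mathrm{AG}}(C_\Gamma),\qquad d_{\mathrm{AG}}(C_\Gamma):=\min_{s\in\Gamma}\lambda(s),$$ where the left-hand side is the error-correction capability of the decoding algorithm of Lee, Bras-Amorós and O'Sullivan (extended to one-point codes $C_\Gamma$ on general curves) and $d_{\mathrm{AG}}(C_\Gamma)$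 is the Andersen–Geil lower bound for the minimum distance of $C_\Gamma$. -/

import Mathlib

namespace OnePointAG

section Places

variable (k F : Type*) [Field k] [Field F] [Algebra k F]

/-- A place of `F/k`, given by its normalized discrete valuation: a valuation of `F` with values
in `ℤ ∪ {∞}` that is trivial on the constants `k` and takes the value `1`. -/
structure Place where
  val : AddValuation F (WithTop ℤ)
  map_const : ∀ c : k, c ≠ 0 → val (algebraMap k F c) = 0
  normalized : ∃ t : F, val t = 1

/-- Divisors of `F/k`. -/
abbrev Divisor := Place k F →₀ ℤ

variable {k F}

namespace Place

lemma val_const_nonneg (P : Place k F) (c : k) : 0 ≤ P.val (algebraMap k F c) := by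
  by_cases hc : c = 0
  · simp [hc]
  · rw [P.map_const c hc]

/-- The valuation ring of the place `P`. -/
def integers (P : Place k F) : Subalgebra k F where
  carrier := {f | 0 ≤ P.val f}
  mul_mem' {f g} hf hg := by
    simp only [Set.mem_ofPred_eq] at hf hg ⊢
    rw [AddValuation.map_mul]
    exact add_nonneg hf hg
  add_mem' {f g} hf hg := P.val.map_le_add hf hg
  algebraMap_mem' c := P.val_const_nonneg c

/-- The maximal ideal of the valuation ring of the place `P`. -/
def maxIdeal (P : Place k F) : Ideal P.integers where
  carrier := {f | 0 < P.val (f : F)}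
  zero_mem' := by simp
  add_mem' {f g} hf hg := by
    simp only [Set.mem_ofPred_eq] at hf hg ⊢
    exact P.val.map_lt_add hf hg
  smul_mem' c f hf := by
    simp only [Set.mem_ofPred_eq, smul_eq_mul] at hf ⊢
    have hc : 0 ≤ P.val (c : F) := c.2
    have h : P.val ((c * f : P.integers) : F) = P.val (c : F) + P.val (f : F) := by
      simp
    rw [h]
    exact lt_of_lt_of_le hf (le_add_of_nonneg_left hc)

/-- The degree of a place: the degree of its residue field over `k`. -/
noncomputable def degree (P : Place k F) : ℕ := Module.finrank k (P.integers ⧸ P.maxIdeal)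

/-- The integer `v_P(f)`, meant for `f ≠ 0`. -/
noncomputable def ord (P : Place k F) (f : F) : ℤ := (P.val f).untopD 0

open Classical in
/-- The value `f(P)` of `f` at a place `P` of degree one, for `f` regular at `P`: the constant
`c` with `f ≡ c` modulo the maximal ideal of `P`. -/
noncomputable def eval (P : Place k F) (f : F) : k :=
  if h : ∃ c : k, 0 < P.val (f - algebraMap k F c) then h.choose else 0

end Place

/-- The Riemann-Roch space `𝓛(G)`; zero belongs to it because `v_P(0) = ∞`. -/
def rrSpace (G : Divisor k F) : Set F :=
  {f | ∀ P : Place k F, ((-G P : ℤ) : WithTop ℤ) ≤ P.val f}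

/-- `𝓛(G + ∞Q) = ⋃ᵢ 𝓛(G + iQ)`. -/
def rrSpaceInfty (G : Divisor k F) (Q : Place k F) : Set F :=
  ⋃ i : ℕ, rrSpace (G + Finsupp.single Q (i : ℤ))

/-- The pole divisor `(f)_∞` of the nonzero function `f` is `G`. -/
def HasPoleDivisor (f : F) (G : Divisor k F) : Prop :=
  f ≠ 0 ∧ ∀ P : Place k F, G P = max (-P.ord f) 0

/-- The Weierstrass semigroup `H(Q)`: the set of nongaps at `Q`. -/
def weierstrass (Q : Place k F) : Set ℕ :=
  {m | ∃ f : F, HasPoleDivisor f (Finsupp.single Q (m : ℤ))}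

/-- The one-point code `C_u = {(f(P₁), …, f(Pₙ)) | f ∈ 𝓛(uQ)}`. -/
def code {n : ℕ} (Q : Place k F) (P : Fin n → Place k F) (u : ℤ) : Set (Fin n → k) :=
  {w | ∃ f ∈ rrSpace (Finsupp.single Q u), w = fun i => (P i).eval f}

/-- `S_indep = {u | C_u ≠ C_{u-1}}`. Negative `u` are left out, `C_u` being zero for them. -/
def indep {n : ℕ} (Q : Place k F) (P : Fin n → Place k F) : Set ℕ :=
  {u | code Q P (u : ℤ) ≠ code Q P ((u : ℤ) - 1)}

/-- The set `{j ∈ H(Q) | j + s ∈ S_indep}`. -/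
def lambdaSet {n : ℕ} (Q : Place k F) (P : Fin n → Place k F) (s : ℕ) : Set ℕ :=
  {j | j ∈ weierstrass Q ∧ j + s ∈ indep Q P}

/-- `λ(s)`, the number of `j ∈ H(Q)` with `j + s ∈ S_indep`. -/
noncomputable def lam {n : ℕ} (Q : Place k F) (P : Fin n → Place k F) (s : ℕ) : ℕ :=
  (lambdaSet Q P s).ncard

/-- `η` is an element of `𝓛(-D + ∞Q)`, `D = P₁ + ⋯ + Pₙ`, whose pole order at `Q` is minimal
among the nonzero elements of `𝓛(-D + ∞Q)` with pole order at `Q` congruent to `j` mod `a₁`. -/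
def IsEta {n : ℕ} (Q : Place k F) (P : Fin n → Place k F) (a₁ j : ℕ) (η : F) : Prop :=
  let I : Set F := rrSpaceInfty (-∑ i, Finsupp.single (P i) (1 : ℤ)) Q
  η ∈ I ∧ η ≠ 0 ∧ -Q.ord η ≡ (j : ℤ) [ZMOD (a₁ : ℤ)] ∧
    ∀ f ∈ I, f ≠ 0 → -Q.ord f ≡ (j : ℤ) [ZMOD (a₁ : ℤ)] → -Q.ord η ≤ -Q.ord f

end Places

section Exponents

variable {t : ℕ}

/-- The weight `a₁ m₁ + ⋯ + a_t m_t`. -/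
def weight (a m : Fin t → ℕ) : ℕ := ∑ i, a i * m i

/-- The monomial order: `m ≺ n` if `m` has smaller weight, or the weights agree and at the first
index where `m` and `n` differ the entry of `m` is the larger one. -/
def MonLT (a m n : Fin t → ℕ) : Prop :=
  weight a m < weight a n ∨
    (weight a m = weight a n ∧ ∃ i, (∀ j, j < i → m j = n j) ∧ n i < m i)

open Classical in
/-- The `≺`-least exponent vector of weight `b` (it exists whenever all `aᵢ` are positive and `b`
is the weight of some vector, see `minExponent_spec`). -/
noncomputable def minExponent (a : Fin t → ℕ) (b : ℕ) : Fin t → ℕ :=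
  if h : ∃ m, weight a m = b ∧ ∀ m', weight a m' = b → m' ≠ m → MonLT a m m' then h.choose else 0

lemma minExponent_spec (a : Fin t → ℕ) (ha : ∀ i, 0 < a i) (b : ℕ) (hb : ∃ m, weight a m = b) :
    weight a (minExponent a b) = b ∧
      ∀ m', weight a m' = b → m' ≠ minExponent a b → MonLT a (minExponent a b) m' := by
  have h : ∃ m, weight a m = b ∧ ∀ m', weight a m' = b → m' ≠ m → MonLT a m m' := by
    have hfin : {m : Lex (Fin t → ℕ) | weight a (ofLex m) = b}.Finite := by
      apply Set.Finite.subset (s := toLex '' Set.Iic (fun _ : Fin t => b))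
        ((Set.finite_Iic _).image _)
      intro m hm
      refine ⟨ofLex m, ?_, rfl⟩
      intro i
      have h1 : a i * (ofLex m) i ≤ weight a (ofLex m) :=
        Finset.single_le_sum (f := fun i => a i * (ofLex m) i) (fun _ _ => Nat.zero_le _)
          (Finset.mem_univ i)
      have h2 : (ofLex m) i ≤ a i * (ofLex m) i := Nat.le_mul_of_pos_left _ (ha i)
      exact h2.trans (h1.trans (le_of_eq hm))
    obtain ⟨m0, hm0⟩ := hb
    obtain ⟨M, hM, hmax⟩ := hfin.exists_maximal ⟨toLex m0, hm0⟩
    refine ⟨ofLex M, hM, fun m' hm' hne => Or.inr ⟨by rw [hm', hM], ?_⟩⟩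
    have hlt : toLex m' < M := by
      rcases lt_trichotomy (toLex m') M with h | h | h
      · exact h
      · exact absurd (by rw [← h]; rfl) hne
      · exact absurd (hmax hm' h.le) (not_le_of_gt h)
    obtain ⟨i, hi, hi'⟩ := hlt
    exact ⟨i, fun j hj => (hi j hj).symm, hi'⟩
  have e : minExponent a b = h.choose := by
    unfold minExponent
    rw [dif_pos h]
  rw [e]
  exact h.choose_spec

end Exponents

section Nu

variable {k F : Type*} [Field k] [Field F] [Algebra k F] {t : ℕ} [NeZero t]

/-- `b_i = min {m ∈ H(Q) | m ≡ i mod a₁}`. -/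
noncomputable def minNongap (Q : Place k F) (a₁ i : ℕ) : ℕ :=
  sInf {m | m ∈ weierstrass Q ∧ m ≡ i [MOD a₁]}

/-- `y_i = x₁^{ℓ₁} ⋯ x_t^{ℓ_t}`, where `L_i = (ℓ₁, …, ℓ_t)` is the `≺`-least vector of weight
`b_i`; its first entry `ℓ₁` is `0` by the minimality of `b_i`. -/
noncomputable def yMon (Q : Place k F) (a : Fin t → ℕ) (x : Fin t → F) (i : ℕ) : F :=
  ∏ j, x j ^ minExponent a (minNongap Q (a 0) i) j

/-- `ν(s) = (1/a₁) ∑_{0 ≤ i < a₁} max {-v_Q(η_{i'}) + v_Q(y_i) - s, 0}`, `i' = i + s mod a₁`. -/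
noncomputable def nu (Q : Place k F) (a : Fin t → ℕ) (x : Fin t → F) (η : ℕ → F) (s : ℕ) : ℚ :=
  (1 / (a 0 : ℚ)) * ∑ i ∈ Finset.range (a 0),
    ((max (-Q.ord (η ((i + s) % a 0)) + Q.ord (yMon Q a x i) - (s : ℤ)) 0 : ℤ) : ℚ)

/-- The error-correction capability of the decoding algorithm for `C_Γ`:
half of `min {ν(s) | s ∈ Γ}`. -/
noncomputable def decodingRadius (Q : Place k F) (a : Fin t → ℕ) (x : Fin t → F) (η : ℕ → F)
    (Γ : Finset ℕ) (hΓ : Γ.Nonempty) : ℚ :=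
  Γ.inf' hΓ (nu Q a x η) / 2

/-- The Andersen-Geil bound `d_AG(C_Γ) = min {λ(s) | s ∈ Γ}`. -/
noncomputable def dAG {n : ℕ} (Q : Place k F) (P : Fin n → Place k F)
    (Γ : Finset ℕ) (hΓ : Γ.Nonempty) : ℕ :=
  Γ.inf' hΓ (lam Q P)

end Nu

end OnePointAG

/-!
The set `S = H(Q)` of pole orders of functions regular away from `Q`, and the set `T` of pole
orders of the functions that moreover vanish at `P₁, …, Pₙ`, are both stable under `m ↦ m + a₁`
(multiply by `x₁`). Each of them is therefore determined by its least element in every residue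
class modulo `a₁`: these are the numbers `bᵢ = -v_Q(yᵢ)` for `S` and `-v_Q(ηⱼ)` for `T`.

Passing from `C_{u-1}` to `C_u` adds the functions with pole order exactly `u`. These give nothing
new if `u ∈ T`, since then a multiple of a function vanishing at all `Pᵢ` can be subtracted to lower
the pole order; conversely a coincidence of codewords produces a function witnessing `u ∈ T`. Hence
`S_indep = S \ T`, and `λ(s)` counts the `j ∈ S` with `j + s ∉ T`. In the residue class of `i` these
are the `j ≡ i` with `bᵢ ≤ j < -v_Q(η_{i'}) - s`, whose number is the `i`-th summand of `ν(s)`.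
-/

namespace OnePointAG

section Apery

/-- The set `X` of integers is stable under translation by `a`, and `w i`, for `0 ≤ i < a`, is its
least element congruent to `i` modulo `a`; so `w` lists the Apéry set of `X` with respect to `a`.
The values `w i` for `a ≤ i` are unconstrained. -/
structure IsAperySystem (X : Set ℤ) (a : ℕ) (w : ℕ → ℤ) : Prop where
  add_mem : ∀ m ∈ X, m + a ∈ X
  isLeast : ∀ i < a, IsLeast {m ∈ X | m ≡ i [ZMOD a]} (w i)

variable {X Y : Set ℤ} {a : ℕ} {b c w : ℕ → ℤ}

namespace IsAperySystem

lemma modEq (h : IsAperySystem X a w) {i : ℕ} (hi : i < a) : w i ≡ i [ZMOD a] :=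
  (h.isLeast i hi).1.2

lemma add_mul_mem (h : IsAperySystem X a w) {m : ℤ} (hm : m ∈ X) (d : ℕ) : m + a * d ∈ X := by
  induction d with
  | zero => simpa using hm
  | succ d ih => simpa [mul_add, add_assoc] using h.add_mem _ ih

lemma mem_iff_le (h : IsAperySystem X a w) {i : ℕ} (hi : i < a) {m : ℤ} (hm : m ≡ i [ZMOD a]) :
    m ∈ X ↔ w i ≤ m := by
  refine ⟨fun hmX => (h.isLeast i hi).2 ⟨hmX, hm⟩, fun hle => ?_⟩
  obtain ⟨d, hd⟩ := ((h.modEq hi).trans hm.symm).dvd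
  have hd_nonneg : 0 ≤ d :=
    nonneg_of_mul_nonneg_right (hd ▸ sub_nonneg.2 hle) (by exact_mod_cast Nat.zero_lt_of_lt hi)
  lift d to ℕ using hd_nonneg
  rw [eq_add_of_sub_eq' hd]
  exact h.add_mul_mem (h.isLeast i hi).1.1 d

lemma exists_natCast_mem (h : IsAperySystem X a w) {i : ℕ} (hi : i < a) :
    ∃ u : ℕ, (u : ℤ) ∈ X ∧ u ≡ i [MOD a] := by
  have hmod : i + a * (w i).toNat ≡ i [MOD a] := by simp [Nat.ModEq]
  refine ⟨i + a * (w i).toNat, (h.mem_iff_le hi (Int.natCast_modEq_iff.2 hmod)).2 ?_, hmod⟩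
  calc w i ≤ (w i).toNat := Int.self_le_toNat _
    _ ≤ ((i + a * (w i).toNat : ℕ) : ℤ) := by
      exact_mod_cast (Nat.le_mul_of_pos_left _ (Nat.zero_lt_of_lt hi)).trans (Nat.le_add_left _ _)

end IsAperySystem

lemma isAperySystem_natCast_sInf {S : Set ℕ} (hadd : ∀ m ∈ S, m + a ∈ S)
    (hne : ∀ i < a, ∃ u ∈ S, u ≡ i [MOD a]) :
    IsAperySystem ((↑) '' S) a fun i => (sInf {m | m ∈ S ∧ m ≡ i [MOD a]} : ℕ) where
  add_mem := by
    rintro _ ⟨m, hm, rfl⟩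
    exact ⟨m + a, hadd m hm, Nat.cast_add m a⟩
  isLeast i hi := by
    obtain ⟨hS, hmod⟩ := Nat.sInf_mem (s := {m | m ∈ S ∧ m ≡ i [MOD a]}) (hne i hi)
    refine ⟨⟨Set.mem_image_of_mem _ hS, Int.natCast_modEq_iff.2 hmod⟩, ?_⟩
    rintro _ ⟨⟨m, hm, rfl⟩, hmi⟩
    exact Int.ofNat_le.2 (Nat.sInf_le ⟨hm, Int.natCast_modEq_iff.1 hmi⟩)

lemma mul_card_Ico_filter_modEq {r : ℤ} (hr : 0 < r) {u v : ℤ} (huv : u ≡ v [ZMOD r]) :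
    r * ((Finset.Ico u v).filter (· ≡ u [ZMOD r])).card = max (v - u) 0 := by
  obtain ⟨d, hd⟩ := huv.dvd
  have hceil : ⌈((v : ℚ) - u) / r⌉ = d := by
    have hr' : (r : ℚ) ≠ 0 := by exact_mod_cast hr.ne'
    rw [← Int.cast_sub, hd, Int.cast_mul, mul_div_cancel_left₀ _ hr', Int.ceil_intCast]
  rw [Int.Ico_filter_modEq_card _ _ hr, hceil, sub_self, zero_div, Int.ceil_zero, sub_zero,
    mul_max_of_nonneg _ _ hr.le, mul_zero, hd]

lemma IsAperySystem.mem_and_add_notMem_iff (hX : IsAperySystem X a b) (hY : IsAperySystem Y a c)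
    (s : ℕ) {i : ℕ} (hi : i < a) {m : ℤ} (hm : m ≡ i [ZMOD a]) :
    m ∈ X ∧ m + s ∉ Y ↔ m ∈ Finset.Ico (b i) (c ((i + s) % a) - s) := by
  have hms : m + s ≡ ((i + s) % a : ℕ) [ZMOD a] := by
    push_cast
    exact (hm.add_right _).trans (Int.mod_modEq _ _).symm
  rw [hX.mem_iff_le hi hm, hY.mem_iff_le (Nat.mod_lt _ (Nat.zero_lt_of_lt hi)) hms, not_le,
    Finset.mem_Ico, lt_sub_iff_add_lt]

lemma IsAperySystem.setOf_mem_and_add_notMem_eq (ha : 0 < a) (hX : IsAperySystem X a b)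
    (hY : IsAperySystem Y a c) (s : ℕ) :
    {m | m ∈ X ∧ m + s ∉ Y} = ((Finset.range a).biUnion fun i =>
      (Finset.Ico (b i) (c ((i + s) % a) - s)).filter (· ≡ b i [ZMOD a]) : Finset ℤ) := by
  ext m
  simp only [Set.mem_ofPred_eq, Finset.coe_biUnion, Finset.coe_filter, Finset.coe_range,
    Set.mem_iUnion, Set.mem_Iio, exists_prop]
  constructor
  · intro h
    have hi : (m % a).toNat < a := by have := Int.emod_lt_of_pos m (Int.natCast_pos.2 ha); omega
    have hm : m ≡ (m % a).toNat [ZMOD a] := by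
      rw [Int.toNat_of_nonneg (Int.emod_nonneg m (by exact_mod_cast ha.ne'))]
      exact (Int.mod_modEq m a).symm
    exact ⟨_, hi, (hX.mem_and_add_notMem_iff hY s hi hm).1 h, hm.trans (hX.modEq hi).symm⟩
  · rintro ⟨i, hi, hmem, hm⟩
    exact (hX.mem_and_add_notMem_iff hY s hi (hm.trans (hX.modEq hi))).2 hmem

lemma IsAperySystem.finite_mem_and_add_notMem (ha : 0 < a) (hX : IsAperySystem X a b)
    (hY : IsAperySystem Y a c) (s : ℕ) : {m | m ∈ X ∧ m + s ∉ Y}.Finite := by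
  rw [hX.setOf_mem_and_add_notMem_eq ha hY]
  exact Finset.finite_toSet _

theorem IsAperySystem.mul_ncard_mem_and_add_notMem (ha : 0 < a) (hX : IsAperySystem X a b)
    (hY : IsAperySystem Y a c) (s : ℕ) :
    (a : ℤ) * {m | m ∈ X ∧ m + s ∉ Y}.ncard =
      ∑ i ∈ Finset.range a, max (c ((i + s) % a) - b i - s) 0 := by
  have hdisj : (Finset.range a : Set ℕ).PairwiseDisjoint fun i =>
      (Finset.Ico (b i) (c ((i + s) % a) - s)).filter (· ≡ b i [ZMOD a]) := by
    intro i hi j hj hij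
    refine Finset.disjoint_left.2 fun m hmi hmj => hij ?_
    rw [Finset.mem_coe, Finset.mem_range] at hi hj
    rw [Finset.mem_filter] at hmi hmj
    have hmod := (hX.modEq hi).symm.trans (hmi.2.symm.trans (hmj.2.trans (hX.modEq hj)))
    exact (Int.natCast_modEq_iff.1 hmod).eq_of_lt_of_lt hi hj
  rw [hX.setOf_mem_and_add_notMem_eq ha hY, Set.ncard_coe_finset, Finset.card_biUnion hdisj,
    Nat.cast_sum, Finset.mul_sum]
  refine Finset.sum_congr rfl fun i hi => ?_
  rw [Finset.mem_range] at hi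
  have hc : c ((i + s) % a) ≡ i + s [ZMOD a] := by
    simpa using (hY.modEq (Nat.mod_lt (i + s) ha)).trans
      (Int.natCast_modEq_iff.2 (Nat.mod_modEq (i + s) a))
  have hbc : b i ≡ c ((i + s) % a) - s [ZMOD a] :=
    (hX.modEq hi).trans (by simpa using (hc.sub_right s).symm)
  rw [mul_card_Ico_filter_modEq (by exact_mod_cast ha) hbc, sub_right_comm]

end Apery

variable {k F : Type*} [Field k] [Field F] [Algebra k F]

section Place

namespace Place

variable (P : Place k F)

lemma val_eq_coe_iff {f : F} {m : ℤ} : P.val f = m ↔ f ≠ 0 ∧ P.ord f = m := by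
  constructor
  · intro h
    exact ⟨fun hf => by simp [hf] at h, by simp [ord, h]⟩
  · rintro ⟨hf, rfl⟩
    obtain ⟨m, hm⟩ := WithTop.ne_top_iff_exists.1 ((AddValuation.top_iff P.val).not.2 hf)
    simp [ord, ← hm]

lemma val_eq_ord {f : F} (hf : f ≠ 0) : P.val f = P.ord f :=
  P.val_eq_coe_iff.2 ⟨hf, rfl⟩

lemma val_sub_pos {f g : F} (hf : 0 < P.val f) (hg : 0 < P.val g) : 0 < P.val (f - g) := by
  rw [sub_eq_add_neg]
  exact P.val.map_lt_add hf (by rwa [AddValuation.map_neg])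

lemma eq_zero_of_val_const_pos {c : k} (hc : 0 < P.val (algebraMap k F c)) : c = 0 := by
  by_contra hne
  exact hc.ne' (P.map_const c hne)

lemma exists_val_sub_const_pos (hP : P.degree = 1) {f : F} (hf : 0 ≤ P.val f) :
    ∃ c : k, 0 < P.val (f - algebraMap k F c) := by
  have : Module.Free k (P.integers ⧸ P.maxIdeal) := Module.Free.of_divisionRing k _
  obtain ⟨c, hc⟩ := (Algebra.finrank_eq_one_iff_bijective_algebraMap.1 hP).2
    (Ideal.Quotient.mk P.maxIdeal ⟨f, hf⟩)
  exact ⟨c, Ideal.Quotient.eq.1 hc.symm⟩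

lemma val_sub_eval_pos (hP : P.degree = 1) {f : F} (hf : 0 ≤ P.val f) :
    0 < P.val (f - algebraMap k F (P.eval f)) := by
  have h := P.exists_val_sub_const_pos hP hf
  rw [eval, dif_pos h]
  exact h.choose_spec

lemma eval_eq_eval_iff (hP : P.degree = 1) {f g : F} (hf : 0 ≤ P.val f) (hg : 0 ≤ P.val g) :
    P.eval f = P.eval g ↔ 0 < P.val (f - g) := by
  have hdiff := P.val_sub_pos (P.val_sub_eval_pos hP hf) (P.val_sub_eval_pos hP hg)
  constructor
  · intro h
    rwa [h, sub_sub_sub_cancel_right] at hdiff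
  · intro h
    have hconst := P.val_sub_pos h hdiff
    rw [sub_sub_sub_comm, sub_sub_cancel, sub_sub_cancel, ← map_sub] at hconst
    exact sub_eq_zero.1 (P.eq_zero_of_val_const_pos hconst)

lemma exists_lt_val_sub_const_mul (hP : P.degree = 1) {f h : F} {m : ℤ} (hf : P.val f = m)
    (hh : P.val h = m) : ∃ c : k, m < P.val (f - algebraMap k F c * h) := by
  have hh0 : h ≠ 0 := (P.val_eq_coe_iff.1 hh).1
  have hquot : P.val (f / h) = 0 := by
    rw [AddValuation.map_div, hf, hh]
    exact_mod_cast congrArg ((↑) : ℤ → WithTop ℤ) (sub_self m)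
  obtain ⟨c, hc⟩ := P.exists_val_sub_const_pos hP hquot.ge
  refine ⟨c, ?_⟩
  rw [show f - algebraMap k F c * h = (f / h - algebraMap k F c) * h by field_simp,
    AddValuation.map_mul, hh]
  simpa using WithTop.add_lt_add_right (WithTop.coe_ne_top (a := m)) hc

lemma val_prod_pow {ι : Type*} [Fintype ι] {x : ι → F} {d : ι → ℤ}
    (hx : ∀ i, P.val (x i) = d i) (e : ι → ℕ) :
    P.val (∏ i, x i ^ e i) = (∑ i, e i * d i : ℤ) := by
  classical
  induction (Finset.univ : Finset ι) using Finset.induction_on with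
  | empty => simp
  | insert i s hi ih =>
    rw [Finset.prod_insert hi, Finset.sum_insert hi, AddValuation.map_mul, AddValuation.map_pow,
      ih, hx, ← nsmul_eq_mul, WithTop.coe_add, WithTop.coe_nsmul]

end Place

end Place

lemma coe_add_one_le_iff {m : ℤ} {v : WithTop ℤ} : ((m + 1 : ℤ) : WithTop ℤ) ≤ v ↔ m < v := by
  induction v using WithTop.recTopCoe with
  | top => simp
  | coe v => exact_mod_cast Int.add_one_le_iff

section RiemannRoch

variable {G H : Divisor k F} {Q : Place k F} {f g : F}

lemma mem_rrSpaceInfty_iff :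
    f ∈ rrSpaceInfty G Q ↔ ∀ R, R ≠ Q → ((-G R : ℤ) : WithTop ℤ) ≤ R.val f := by
  simp only [rrSpaceInfty, rrSpace, Set.mem_iUnion, Set.mem_ofPred_eq]
  constructor
  · rintro ⟨i, hi⟩ R hR
    simpa [Finsupp.single_eq_of_ne hR] using hi R
  · intro h
    refine ⟨(-G Q - Q.ord f).toNat, fun R => ?_⟩
    by_cases hR : R = Q
    · subst hR
      by_cases hf : f = 0
      · simp [hf]
      · rw [R.val_eq_ord hf, WithTop.coe_le_coe, Finsupp.add_apply, Finsupp.single_eq_same]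
        omega
    · simpa [Finsupp.single_eq_of_ne hR] using h R hR

lemma mem_rrSpaceInfty_zero_iff : f ∈ rrSpaceInfty 0 Q ↔ ∀ R, R ≠ Q → 0 ≤ R.val f := by
  simp [mem_rrSpaceInfty_iff]

lemma mul_mem_rrSpaceInfty (hf : f ∈ rrSpaceInfty G Q) (hg : g ∈ rrSpaceInfty H Q) :
    f * g ∈ rrSpaceInfty (G + H) Q := by
  rw [mem_rrSpaceInfty_iff] at hf hg ⊢
  intro R hR
  rw [AddValuation.map_mul, Finsupp.add_apply, neg_add, WithTop.coe_add]
  exact add_le_add (hf R hR) (hg R hR)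

lemma sub_mem_rrSpaceInfty (hf : f ∈ rrSpaceInfty G Q) (hg : g ∈ rrSpaceInfty G Q) :
    f - g ∈ rrSpaceInfty G Q := by
  rw [mem_rrSpaceInfty_iff] at hf hg ⊢
  exact fun R hR => R.val.map_le_sub (hf R hR) (hg R hR)

lemma const_mul_mem_rrSpaceInfty (c : k) (hf : f ∈ rrSpaceInfty G Q) :
    algebraMap k F c * f ∈ rrSpaceInfty G Q := by
  rw [← zero_add G]
  exact mul_mem_rrSpaceInfty (mem_rrSpaceInfty_zero_iff.2 fun R _ => R.val_const_nonneg c) hf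

lemma rrSpaceInfty_mono (hGH : G ≤ H) : rrSpaceInfty G Q ⊆ rrSpaceInfty H Q := by
  intro f hf
  rw [mem_rrSpaceInfty_iff] at hf ⊢
  exact fun R hR => (WithTop.coe_le_coe.2 (neg_le_neg (hGH R))).trans (hf R hR)

lemma mem_rrSpace_single_iff {u : ℤ} :
    f ∈ rrSpace (Finsupp.single Q u) ↔ f ∈ rrSpaceInfty 0 Q ∧ ((-u : ℤ) : WithTop ℤ) ≤ Q.val f := by
  rw [mem_rrSpaceInfty_zero_iff]
  constructor
  · intro h
    exact ⟨fun R hR => by simpa [Finsupp.single_eq_of_ne hR] using h R, by simpa using h Q⟩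
  · rintro ⟨hreg, hQ⟩ R
    by_cases hR : R = Q
    · subst hR
      simpa using hQ
    · simpa [Finsupp.single_eq_of_ne hR] using hreg R hR

lemma mem_rrSpace_single_sub_one_iff {u : ℤ} :
    f ∈ rrSpace (Finsupp.single Q (u - 1)) ↔
      f ∈ rrSpaceInfty 0 Q ∧ ((-u : ℤ) : WithTop ℤ) < Q.val f := by
  rw [mem_rrSpace_single_iff, neg_sub', sub_neg_eq_add, coe_add_one_le_iff]

/-- The pole orders at `Q` of the nonzero elements of `𝓛(G + ∞Q)`. They are integers, not natural
numbers, since in an arbitrary extension `F/k` a function may have a zero at `Q` and no pole. -/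
def poleOrders (G : Divisor k F) (Q : Place k F) : Set ℤ :=
  {m | ∃ f ∈ rrSpaceInfty G Q, Q.val f = ((-m : ℤ) : WithTop ℤ)}

lemma neg_ord_mem_poleOrders (hf : f ∈ rrSpaceInfty G Q) (hf0 : f ≠ 0) :
    -Q.ord f ∈ poleOrders G Q :=
  ⟨f, hf, by rw [neg_neg, Q.val_eq_ord hf0]⟩

lemma add_mem_poleOrders {m m' : ℤ} (hm : m ∈ poleOrders G Q) (hm' : m' ∈ poleOrders H Q) :
    m + m' ∈ poleOrders (G + H) Q := by
  obtain ⟨f, hf, hfm⟩ := hm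
  obtain ⟨g, hg, hgm⟩ := hm'
  refine ⟨f * g, mul_mem_rrSpaceInfty hf hg, ?_⟩
  rw [AddValuation.map_mul, hfm, hgm, neg_add, WithTop.coe_add]

lemma poleOrders_mono (hGH : G ≤ H) : poleOrders G Q ⊆ poleOrders H Q :=
  fun _ ⟨f, hf, hfm⟩ => ⟨f, rrSpaceInfty_mono hGH hf, hfm⟩

lemma HasPoleDivisor.mem_rrSpaceInfty_zero {u : ℤ} (h : HasPoleDivisor f (Finsupp.single Q u)) :
    f ∈ rrSpaceInfty 0 Q := by
  refine mem_rrSpaceInfty_zero_iff.2 fun R hR => ?_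
  have hR' := h.2 R
  rw [Finsupp.single_eq_of_ne hR] at hR'
  rw [R.val_eq_ord h.1, WithTop.coe_nonneg]
  omega

lemma HasPoleDivisor.val_eq {u : ℤ} (hu : 0 < u) (h : HasPoleDivisor f (Finsupp.single Q u)) :
    Q.val f = ((-u : ℤ) : WithTop ℤ) := by
  have hQ := h.2 Q
  rw [Finsupp.single_eq_same] at hQ
  exact Q.val_eq_coe_iff.2 ⟨h.1, by omega⟩

lemma hasPoleDivisor_single {u : ℤ} (hu : 0 ≤ u) (hf : f ∈ rrSpaceInfty 0 Q)
    (hfu : Q.val f = ((-u : ℤ) : WithTop ℤ)) : HasPoleDivisor f (Finsupp.single Q u) := by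
  obtain ⟨hf0, hord⟩ := Q.val_eq_coe_iff.1 hfu
  refine ⟨hf0, fun R => ?_⟩
  by_cases hR : R = Q
  · subst hR
    rw [Finsupp.single_eq_same]
    omega
  · have hreg := mem_rrSpaceInfty_zero_iff.1 hf R hR
    rw [R.val_eq_ord hf0, WithTop.coe_nonneg] at hreg
    rw [Finsupp.single_eq_of_ne hR]
    omega

lemma mem_weierstrass_iff {u : ℕ} : u ∈ weierstrass Q ↔ (u : ℤ) ∈ poleOrders 0 Q := by
  refine ⟨?_, fun ⟨f, hf, hfu⟩ => ⟨f, hasPoleDivisor_single u.cast_nonneg hf hfu⟩⟩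
  rintro ⟨f, hf⟩
  rcases u.eq_zero_or_pos with rfl | hu
  · exact ⟨1, mem_rrSpaceInfty_zero_iff.2 fun R _ => by simp, by simp⟩
  · exact ⟨f, hf.mem_rrSpaceInfty_zero, hf.val_eq (by exact_mod_cast hu)⟩

lemma add_mem_weierstrass {u v : ℕ} (hu : u ∈ weierstrass Q) (hv : v ∈ weierstrass Q) :
    u + v ∈ weierstrass Q := by
  rw [mem_weierstrass_iff] at *
  simpa using add_mem_poleOrders hu hv

end RiemannRoch

section Code

variable {n : ℕ} {Q : Place k F} {P : Fin n → Place k F} {f g : F} {u : ℤ}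

/-- The divisor `D = P₁ + ⋯ + Pₙ` of the evaluation points. -/
noncomputable abbrev evalDivisor (P : Fin n → Place k F) : Divisor k F :=
  ∑ i, Finsupp.single (P i) (1 : ℤ)

lemma evalDivisor_nonneg : 0 ≤ evalDivisor P :=
  Finset.sum_nonneg fun _ _ => Finsupp.single_nonneg.2 zero_le_one

lemma evalDivisor_apply_self (hPinj : Function.Injective P) (i : Fin n) :
    evalDivisor P (P i) = 1 := by
  classical simp [Finsupp.single_apply, hPinj.eq_iff]

lemma evalDivisor_apply_of_notMem_range {R : Place k F} (hR : R ∉ Set.range P) :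
    evalDivisor P R = 0 := by
  classical
  rw [Finsupp.finsetSum_apply]
  exact Finset.sum_eq_zero fun i _ => Finsupp.single_eq_of_ne fun h => hR ⟨i, h.symm⟩

lemma mem_rrSpaceInfty_neg_evalDivisor_iff (hPinj : Function.Injective P) (hPQ : ∀ i, P i ≠ Q) :
    f ∈ rrSpaceInfty (-evalDivisor P) Q ↔ f ∈ rrSpaceInfty 0 Q ∧ ∀ i, 0 < (P i).val f := by
  have hval (i : Fin n) :
      ((-(-evalDivisor P) (P i) : ℤ) : WithTop ℤ) ≤ (P i).val f ↔ 0 < (P i).val f := by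
    rw [Finsupp.neg_apply, neg_neg, evalDivisor_apply_self hPinj]
    exact coe_add_one_le_iff (m := 0)
  constructor
  · intro hf
    exact ⟨rrSpaceInfty_mono (neg_nonpos.2 evalDivisor_nonneg) hf,
      fun i => (hval i).1 (mem_rrSpaceInfty_iff.1 hf _ (hPQ i))⟩
  · rintro ⟨hreg, hpos⟩
    refine mem_rrSpaceInfty_iff.2 fun R hR => ?_
    by_cases hRP : R ∈ Set.range P
    · obtain ⟨i, rfl⟩ := hRP
      exact (hval i).2 (hpos i)
    · rw [Finsupp.neg_apply, evalDivisor_apply_of_notMem_range hRP]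
      simpa using mem_rrSpaceInfty_zero_iff.1 hreg R hR

lemma eval_eq_eval_iff_sub_mem (hP : ∀ i, (P i).degree = 1) (hPinj : Function.Injective P)
    (hPQ : ∀ i, P i ≠ Q) (hf : f ∈ rrSpaceInfty 0 Q) (hg : g ∈ rrSpaceInfty 0 Q) :
    ((fun i => (P i).eval f) = fun i => (P i).eval g) ↔
      f - g ∈ rrSpaceInfty (-evalDivisor P) Q := by
  rw [mem_rrSpaceInfty_neg_evalDivisor_iff hPinj hPQ, funext_iff,
    and_iff_right (sub_mem_rrSpaceInfty hf hg)]
  rw [mem_rrSpaceInfty_zero_iff] at hf hg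
  exact forall_congr' fun i => (P i).eval_eq_eval_iff (hP i) (hf _ (hPQ i)) (hg _ (hPQ i))

lemma code_sub_one_subset : code Q P (u - 1) ⊆ code Q P u := by
  rintro _ ⟨f, hf, rfl⟩
  obtain ⟨hreg, hlt⟩ := mem_rrSpace_single_sub_one_iff.1 hf
  exact ⟨f, mem_rrSpace_single_iff.2 ⟨hreg, hlt.le⟩, rfl⟩

lemma code_subset_code_sub_one (hQ : Q.degree = 1) (hP : ∀ i, (P i).degree = 1)
    (hPinj : Function.Injective P) (hPQ : ∀ i, P i ≠ Q)
    (hu : u ∈ poleOrders 0 Q → u ∈ poleOrders (-evalDivisor P) Q) :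
    code Q P u ⊆ code Q P (u - 1) := by
  rintro _ ⟨f, hf, rfl⟩
  obtain ⟨hreg, hle⟩ := mem_rrSpace_single_iff.1 hf
  rcases hle.lt_or_eq with hlt | heq
  · exact ⟨f, mem_rrSpace_single_sub_one_iff.2 ⟨hreg, hlt⟩, rfl⟩
  · obtain ⟨h, hh, hhu⟩ := hu ⟨f, hreg, heq.symm⟩
    obtain ⟨c, hc⟩ := Q.exists_lt_val_sub_const_mul hQ heq.symm hhu
    have hch := const_mul_mem_rrSpaceInfty c hh
    have hgreg : f - algebraMap k F c * h ∈ rrSpaceInfty 0 Q :=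
      sub_mem_rrSpaceInfty hreg (rrSpaceInfty_mono (neg_nonpos.2 evalDivisor_nonneg) hch)
    refine ⟨f - algebraMap k F c * h, mem_rrSpace_single_sub_one_iff.2 ⟨hgreg, hc⟩, ?_⟩
    rwa [eval_eq_eval_iff_sub_mem hP hPinj hPQ hreg hgreg, sub_sub_cancel]

lemma mem_poleOrders_of_code_subset (hP : ∀ i, (P i).degree = 1) (hPinj : Function.Injective P)
    (hPQ : ∀ i, P i ≠ Q) (hu : u ∈ poleOrders 0 Q) (hcode : code Q P u ⊆ code Q P (u - 1)) :
    u ∈ poleOrders (-evalDivisor P) Q := by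
  obtain ⟨f, hreg, hfu⟩ := hu
  obtain ⟨g, hg, hfg⟩ := hcode ⟨f, mem_rrSpace_single_iff.2 ⟨hreg, hfu.ge⟩, rfl⟩
  obtain ⟨hgreg, hlt⟩ := mem_rrSpace_single_sub_one_iff.1 hg
  refine ⟨f - g, (eval_eq_eval_iff_sub_mem hP hPinj hPQ hreg hgreg).1 hfg, ?_⟩
  rw [← hfu] at hlt ⊢
  exact AddValuation.map_sub_eq_of_lt_left _ hlt

theorem mem_indep_iff (hQ : Q.degree = 1) (hP : ∀ i, (P i).degree = 1)
    (hPinj : Function.Injective P) (hPQ : ∀ i, P i ≠ Q) {u : ℕ} :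
    u ∈ indep Q P ↔ u ∈ weierstrass Q ∧ (u : ℤ) ∉ poleOrders (-evalDivisor P) Q := by
  have hcode : code Q P (u : ℤ) = code Q P ((u : ℤ) - 1) ↔
      ((u : ℤ) ∈ poleOrders 0 Q → (u : ℤ) ∈ poleOrders (-evalDivisor P) Q) :=
    ⟨fun h hu => mem_poleOrders_of_code_subset hP hPinj hPQ hu h.subset,
      fun h => (code_subset_code_sub_one hQ hP hPinj hPQ h).antisymm code_sub_one_subset⟩
  rw [mem_weierstrass_iff, ← Classical.not_imp]
  exact hcode.not

lemma natCast_image_lambdaSet (hQ : Q.degree = 1) (hP : ∀ i, (P i).degree = 1)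
    (hPinj : Function.Injective P) (hPQ : ∀ i, P i ≠ Q) {s : ℕ} (hs : s ∈ weierstrass Q) :
    ((↑) '' lambdaSet Q P s : Set ℤ) =
      {m | m ∈ ((↑) '' weierstrass Q : Set ℤ) ∧ m + s ∉ poleOrders (-evalDivisor P) Q} := by
  ext m
  constructor
  · rintro ⟨j, ⟨hj, hjs⟩, rfl⟩
    exact ⟨⟨j, hj, rfl⟩, by exact_mod_cast ((mem_indep_iff hQ hP hPinj hPQ).1 hjs).2⟩
  · rintro ⟨⟨j, hj, rfl⟩, hjs⟩
    exact ⟨j, ⟨hj, (mem_indep_iff hQ hP hPinj hPQ).2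
      ⟨add_mem_weierstrass hj hs, by exact_mod_cast hjs⟩⟩, rfl⟩

end Code

section Generators

lemma exists_weight_eq_of_mem_closure {t : ℕ} {a : Fin t → ℕ} {b : ℕ}
    (hb : b ∈ AddSubmonoid.closure (Set.range a)) : ∃ m, weight a m = b := by
  obtain ⟨m, hm⟩ := AddSubmonoid.mem_closure_range_iff_of_fintype.1 hb
  exact ⟨m, by simpa [weight, mul_comm] using hm.symm⟩

variable {n : ℕ} {Q : Place k F} {P : Fin n → Place k F}

lemma isAperySystem_poleOrders_of_isEta {a₁ : ℕ} (ha₁ : a₁ ∈ weierstrass Q) {η : ℕ → F}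
    (hη : ∀ j < a₁, IsEta Q P a₁ j (η j)) :
    IsAperySystem (poleOrders (-evalDivisor P) Q) a₁ fun j => -Q.ord (η j) where
  add_mem m hm := by
    simpa using add_mem_poleOrders hm (mem_weierstrass_iff.1 ha₁)
  isLeast j hj := by
    obtain ⟨hmem, hne, hmod, hmin⟩ := hη j hj
    refine ⟨⟨neg_ord_mem_poleOrders hmem hne, hmod⟩, ?_⟩
    rintro m ⟨⟨f, hf, hfm⟩, hmj⟩
    obtain ⟨hf0, hord⟩ := Q.val_eq_coe_iff.1 hfm
    obtain rfl : m = -Q.ord f := by omega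
    exact hmin f hf hf0 hmj

lemma isAperySystem_minNongap_of_isEta {a₁ : ℕ} (ha₁ : a₁ ∈ weierstrass Q) {η : ℕ → F}
    (hη : ∀ j < a₁, IsEta Q P a₁ j (η j)) :
    IsAperySystem ((↑) '' weierstrass Q) a₁ fun i => minNongap Q a₁ i := by
  refine isAperySystem_natCast_sInf (fun _ hm => add_mem_weierstrass hm ha₁) fun i hi => ?_
  obtain ⟨u, hu, hui⟩ := (isAperySystem_poleOrders_of_isEta ha₁ hη).exists_natCast_mem hi
  exact ⟨u, mem_weierstrass_iff.2 (poleOrders_mono (neg_nonpos.2 evalDivisor_nonneg) hu), hui⟩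

lemma lambdaSet_finite (hQ : Q.degree = 1) (hP : ∀ i, (P i).degree = 1)
    (hPinj : Function.Injective P) (hPQ : ∀ i, P i ≠ Q) {a₁ : ℕ} (ha₁_pos : 0 < a₁)
    (ha₁ : a₁ ∈ weierstrass Q) {η : ℕ → F} (hη : ∀ j < a₁, IsEta Q P a₁ j (η j)) {s : ℕ}
    (hs : s ∈ weierstrass Q) : (lambdaSet Q P s).Finite := by
  rw [← Set.finite_image_iff (Nat.cast_injective (R := ℤ)).injOn,
    natCast_image_lambdaSet hQ hP hPinj hPQ hs]
  exact (isAperySystem_minNongap_of_isEta ha₁ hη).finite_mem_and_add_notMem ha₁_pos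
    (isAperySystem_poleOrders_of_isEta ha₁ hη) s

lemma mul_lam_eq_sum (hQ : Q.degree = 1) (hP : ∀ i, (P i).degree = 1)
    (hPinj : Function.Injective P) (hPQ : ∀ i, P i ≠ Q) {a₁ : ℕ} (ha₁_pos : 0 < a₁)
    (ha₁ : a₁ ∈ weierstrass Q) {η : ℕ → F} (hη : ∀ j < a₁, IsEta Q P a₁ j (η j)) {s : ℕ}
    (hs : s ∈ weierstrass Q) :
    (a₁ : ℤ) * lam Q P s =
      ∑ i ∈ Finset.range a₁, max (-Q.ord (η ((i + s) % a₁)) - minNongap Q a₁ i - s) 0 := by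
  rw [lam, ← Set.ncard_image_of_injective _ (Nat.cast_injective (R := ℤ)),
    natCast_image_lambdaSet hQ hP hPinj hPQ hs]
  exact (isAperySystem_minNongap_of_isEta ha₁ hη).mul_ncard_mem_and_add_notMem ha₁_pos
    (isAperySystem_poleOrders_of_isEta ha₁ hη) s

lemma ord_yMon {t : ℕ} [NeZero t] {a : Fin t → ℕ} (ha : ∀ i, 0 < a i) {x : Fin t → F}
    (hx : ∀ i, HasPoleDivisor (x i) (Finsupp.single Q (a i : ℤ))) {i : ℕ}
    (hi : minNongap Q (a 0) i ∈ AddSubmonoid.closure (Set.range a)) :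
    Q.ord (yMon Q a x i) = -(minNongap Q (a 0) i : ℤ) := by
  have hweight := (minExponent_spec a ha _ (exists_weight_eq_of_mem_closure hi)).1
  have hval := Q.val_prod_pow (fun j => (hx j).val_eq (by exact_mod_cast ha j))
    (minExponent a (minNongap Q (a 0) i))
  rw [yMon, (Q.val_eq_coe_iff.1 hval).2]
  conv_rhs => rw [← hweight, weight]
  simp [mul_comm]

theorem nu_eq_lam (hQ : Q.degree = 1) (hP : ∀ i, (P i).degree = 1)
    (hPinj : Function.Injective P) (hPQ : ∀ i, P i ≠ Q) {t : ℕ} [NeZero t] {a : Fin t → ℕ}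
    (ha : ∀ i, 0 < a i) (hgen : (AddSubmonoid.closure (Set.range a) : Set ℕ) = weierstrass Q)
    {x : Fin t → F} (hx : ∀ i, HasPoleDivisor (x i) (Finsupp.single Q (a i : ℤ))) {η : ℕ → F}
    (hη : ∀ j < a 0, IsEta Q P (a 0) j (η j)) {s : ℕ} (hs : s ∈ weierstrass Q) :
    nu Q a x η s = lam Q P s := by
  have ha₀ : a 0 ∈ weierstrass Q := ⟨x 0, hx 0⟩
  have hord : ∀ i < a 0, Q.ord (yMon Q a x i) = -(minNongap Q (a 0) i : ℤ) := by
    intro i hi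
    have hb : minNongap Q (a 0) i ∈ weierstrass Q := Nat.cast_injective.mem_set_image.1
      ((isAperySystem_minNongap_of_isEta ha₀ hη).isLeast i hi).1.1
    exact ord_yMon ha hx (hgen.ge hb)
  have hsum : ∑ i ∈ Finset.range (a 0),
      max (-Q.ord (η ((i + s) % a 0)) + Q.ord (yMon Q a x i) - (s : ℤ)) 0 = a 0 * lam Q P s := by
    rw [mul_lam_eq_sum hQ hP hPinj hPQ (ha 0) ha₀ hη hs]
    refine Finset.sum_congr rfl fun i hi => ?_
    rw [hord i (Finset.mem_range.1 hi), ← sub_eq_add_neg]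
  have ha₀_ne : (a 0 : ℚ) ≠ 0 := by exact_mod_cast (ha 0).ne'
  rw [nu, ← Int.cast_sum, hsum]
  push_cast
  rw [one_div, inv_mul_cancel_left₀ ha₀_ne]

end Generators

end OnePointAG

open OnePointAG in
theorem mainTheorem3_general {k F : Type*} [Field k] [Field F] [Algebra k F]
    {n : ℕ} (Q : Place k F) (P : Fin n → Place k F)
    (hQ : Q.degree = 1) (hP : ∀ i, (P i).degree = 1)
    (hPinj : Function.Injective P) (hPQ : ∀ i, P i ≠ Q)
    {t : ℕ} [NeZero t] (a : Fin t → ℕ) (ha : ∀ i, 0 < a i)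
    (hgen : (AddSubmonoid.closure (Set.range a) : Set ℕ) = weierstrass Q)
    (x : Fin t → F) (hx : ∀ i, HasPoleDivisor (x i) (Finsupp.single Q (a i : ℤ)))
    (η : ℕ → F) (hη : ∀ j < a 0, IsEta Q P (a 0) j (η j)) :
    (∀ s ∈ weierstrass Q, (lambdaSet Q P s).Finite ∧ nu Q a x η s = (lam Q P s : ℚ)) ∧
    ∀ (Γ : Finset ℕ) (hΓ : Γ.Nonempty), (Γ : Set ℕ) ⊆ weierstrass Q →
      decodingRadius Q a x η Γ hΓ = (dAG Q P Γ hΓ : ℚ) / 2 := by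
  have key : ∀ s ∈ weierstrass Q,
      (lambdaSet Q P s).Finite ∧ nu Q a x η s = (lam Q P s : ℚ) := fun s hs =>
    ⟨lambdaSet_finite hQ hP hPinj hPQ (ha 0) ⟨x 0, hx 0⟩ hη hs,
      nu_eq_lam hQ hP hPinj hPQ ha hgen hx hη hs⟩
  refine ⟨key, fun Γ hΓ hΓS => ?_⟩
  rw [decodingRadius, dAG, Finset.apply_inf'_eq_inf'_comp hΓ (Nat.cast : ℕ → ℚ) Nat.cast_min]
  exact congrArg (· / 2) (Finset.inf'_congr hΓ rfl fun s hs => (key s (hΓS hs)).2)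

theorem mainTheorem3 {k F : Type*} [Field k] [Finite k] [Field F] [Algebra k F]
    [Algebra (RatFunc k) F] [IsScalarTower k (RatFunc k) F] [FunctionField k F]
    {n : ℕ} (Q : OnePointAG.Place k F) (P : Fin n → OnePointAG.Place k F)
    (hQ : Q.degree = 1) (hP : ∀ i, (P i).degree = 1)
    (hPinj : Function.Injective P) (hPQ : ∀ i, P i ≠ Q)
    {t : ℕ} [NeZero t] (a : Fin t → ℕ) (ha : ∀ i, 0 < a i)
    (hgen : (AddSubmonoid.closure (Set.range a) : Set ℕ) = OnePointAG.weierstrass Q)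
    (x : Fin t → F) (hx : ∀ i, OnePointAG.HasPoleDivisor (x i) (Finsupp.single Q (a i : ℤ)))
    (η : ℕ → F) (hη : ∀ j < a 0, OnePointAG.IsEta Q P (a 0) j (η j)) :
    (∀ s ∈ OnePointAG.weierstrass Q,
      (OnePointAG.lambdaSet Q P s).Finite ∧
        OnePointAG.nu Q a x η s = (OnePointAG.lam Q P s : ℚ)) ∧
    ∀ (Γ : Finset ℕ) (hΓ : Γ.Nonempty), (Γ : Set ℕ) ⊆ OnePointAG.weierstrass Q →
      OnePointAG.decodingRadius Q a x η Γ hΓ = (OnePointAG.dAG Q P Γ hΓ : ℚ) / 2 :=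
  mainTheorem3_general Q P hQ hP hPinj hPQ a ha hgen x hx η hη
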